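/- Let $I,X,Y,Z$ be the single-qubit Pauli matrices (with $I$ the identity), and let $(E_a)_{a=0}^{N}$, $N=4^7-1$, be the $4^7$ seven-qubit Pauli strings, i.e. all tensor products of seven matrices from $\{I,X,Y,Z\}$, with $E_0=\mathbb{1}$. On $14$ qubits $A_1,\dots,A_7,B_1,\dots,B_7$ define $$\Phi_{\mathrm{E8}}=\sum_{i=0}^{3}x_i\,\mathcal{P}\big\{P_+^{\otimes(7-2i)}\otimes P_-^{\otimes 2i}\big\},\qquad x_0=\tfrac{113}{1119744},\ x_1=\tfrac{17}{124416},\ x_2=\tfrac{1}{13824},\ x_3=\tfrac{1}{1536},$$ where $P_\pm=\frac12(I\pm\mathrm{SWAP})$ acts on a qubit pair $(A_k,B_k)$ and $\mathcal{P}\{\cdot\}$ is the sum over all permutations of the seven tensor factors (pairs) that yield distinct terms, i.e. over all choices of the $2i$ pairs carrying $P_-$. Then the following semidefinite feasibility problem is infeasible: there is no positive semidefinite matrix $\Gamma=(\Gamma_{ab})_{a,b=0}^{N}$ (complex Hermitian; in particular, no real symmetric one) such that for all $a,b\in\{0,\dots,N\}$ $$\Gamma_{00}=1,\qquad \Gamma_{a0}=\Gamma_{aa},\qquad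 \Gamma_{ab}=0\ \text{ if }\ E_a^\dagger E_b=-E_bE_a^\dagger,\qquad \Gamma_{aa}=\operatorname{tr}\big((E_a\otimes E_a^\dagger)\,\Phi_{\mathrm{E8}}\big),$$ where in the last condition $E_a$ acts on $A_1\cdots A_7$ and $E_a^\dagger$ on $B_1\cdots B_7$. -/

import Mathlib

open scoped Matrix Kronecker ComplexOrder

noncomputable section

namespace E8State

/-- Computational-basis labels of `n` qubits. -/
abbrev Qubits (n : ℕ) : Type := Fin n → Fin 2

/-- Labels of `n`-qubit Pauli strings: `0, 1, 2, 3` stand for `I, X, Y, Z` at each site, so that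
the label `0` is the identity string. -/
abbrev PauliLabel (n : ℕ) : Type := Fin n → Fin 4

/-- The single-qubit Pauli matrices `I, X, Y, Z`. -/
def pauli : Fin 4 → Matrix (Fin 2) (Fin 2) ℂ :=
  ![1, !![0, 1; 1, 0], !![0, -Complex.I; Complex.I, 0], !![1, 0; 0, -1]]

/-- The Pauli string `E_a`, the tensor product of the matrices `pauli (a k)` over the sites `k`. -/
def pauliString {n : ℕ} (a : PauliLabel n) : Matrix (Qubits n) (Qubits n) ℂ :=
  Matrix.of fun x y => ∏ k, pauli (a k) (x k) (y k)

/-- The swap operator on a pair of qubits. -/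
def swap : Matrix (Fin 2 × Fin 2) (Fin 2 × Fin 2) ℂ :=
  Matrix.of fun p q => if p.1 = q.2 ∧ p.2 = q.1 then 1 else 0

/-- The projector `P₊` onto the symmetric subspace of a qubit pair. -/
def Pplus : Matrix (Fin 2 × Fin 2) (Fin 2 × Fin 2) ℂ := (1 / 2 : ℂ) • (1 + swap)

/-- The projector `P₋` onto the antisymmetric subspace of a qubit pair. -/
def Pminus : Matrix (Fin 2 × Fin 2) (Fin 2 × Fin 2) ℂ := (1 / 2 : ℂ) • (1 - swap)

/-- The operator on `A₁…A₇ B₁…B₇` that is the tensor product of `P₋` on the pairs `(A_k, B_k)`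
with `k ∈ T` and of `P₊` on the pairs with `k ∉ T`. A basis label is a pair
`(x, x')` of a label `x` for `A₁…A₇` and a label `x'` for `B₁…B₇`. -/
def projTerm (T : Finset (Fin 7)) : Matrix (Qubits 7 × Qubits 7) (Qubits 7 × Qubits 7) ℂ :=
  Matrix.of fun p q =>
    ∏ k, (if k ∈ T then Pminus else Pplus) (p.1 k, p.2 k) (q.1 k, q.2 k)

/-- The coefficients `x₀, x₁, x₂, x₃` of the state. -/
def coeff : Fin 4 → ℂ := ![113 / 1119744, 17 / 124416, 1 / 13824, 1 / 1536]

/-- The state `Φ_E8 = ∑ᵢ xᵢ 𝒫{P₊^{⊗(7-2i)} ⊗ P₋^{⊗2i}}`. The distinct terms of `𝒫{·}` are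
labelled by the `2i`-element sets `T` of pairs that carry `P₋`. -/
def PhiE8 : Matrix (Qubits 7 × Qubits 7) (Qubits 7 × Qubits 7) ℂ :=
  ∑ i : Fin 4, coeff i •
    ∑ T ∈ (Finset.univ : Finset (Fin 7)).powersetCard (2 * (i : ℕ)), projTerm T

/-- `Γ` is a feasible point of the semidefinite program: a Hermitian positive semidefinite
matrix indexed by the 7-qubit Pauli strings that satisfies all the constraints. Real symmetric
matrices are included. -/
structure IsFeasible (Γ : Matrix (PauliLabel 7) (PauliLabel 7) ℂ) : Prop where
  posSemidef : Γ.PosSemidef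
  zero_zero : Γ 0 0 = 1
  col_zero : ∀ a, Γ a 0 = Γ a a
  anticomm : ∀ a b,
    (pauliString a)ᴴ * pauliString b = -(pauliString b * (pauliString a)ᴴ) → Γ a b = 0
  diag : ∀ a, Γ a a = ((pauliString a ⊗ₖ (pauliString a)ᴴ) * PhiE8).trace

end E8State

end

/-! Infeasibility is shown by a dual certificate: a positive semidefinite integer kernel
`dualKernel` D on Pauli labels that vanishes at every pair of distinct nonzero commuting labels. For
feasible Γ, the sum of D(x,y)Γ(x,y) is nonnegative by the Schur product theorem. Off row 0, column 0
and the diagonal every term vanishes: Γ is zero on anticommuting pairs and D on commuting ones. As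
Γ(x,0) = Γ(x,x), the sum depends only on the diagonal of Γ, which Φ_E8 fixes as a function of the
weight, and it turns out to be negative.

D is invariant under permuting the sites and, at each site, the letters X, Y, Z. It is a sum of
terms (PSD table in the two weights) × (zonal kernel). The zonal kernels follow the block
diagonalisation of this symmetry: `siteKernel` is the nontrivial part on {X, Y, Z}, and the pair
differences of supports are those of two-row representations of the symmetric group. Hence
`isPosKernel_dualKernel`. By symmetry D depends only on the site counts of a pair
(`dualKernel_eq_dualValue`), so its vanishing (`dualValue_eq_zero_of_even`) and its values
(`dualWeight_values`) are finite integer checks. -/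

open scoped Matrix Kronecker ComplexOrder

namespace E8State

/-! ### Positive semidefinite integer kernels -/

/-- An integer kernel whose matrix is positive semidefinite. -/
def IsPosKernel {ι : Type*} (K : ι → ι → ℤ) : Prop :=
  (Matrix.of fun x y => (K x y : ℂ)).PosSemidef

section IsPosKernel

variable {ι : Type*}

theorem IsPosKernel.zero : IsPosKernel (fun _ _ : ι => 0) := by
  have h : (Matrix.of fun _ _ : ι => ((0 : ℤ) : ℂ)) = 0 := by ext; simp
  rw [IsPosKernel, h]
  exact Matrix.PosSemidef.zero

theorem IsPosKernel.add {K L : ι → ι → ℤ} (hK : IsPosKernel K) (hL : IsPosKernel L) :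
    IsPosKernel fun x y => K x y + L x y := by
  have h := Matrix.PosSemidef.add hK hL
  unfold IsPosKernel
  convert h using 1
  ext x y
  simp

theorem IsPosKernel.sum {α : Type*} (s : Finset α) {K : α → ι → ι → ℤ}
    (hK : ∀ k ∈ s, IsPosKernel (K k)) : IsPosKernel fun x y => ∑ k ∈ s, K k x y := by
  classical
  induction s using Finset.induction_on with
  | empty => simpa using IsPosKernel.zero
  | insert k s hk ih =>
    simp only [Finset.sum_insert hk]
    exact (hK k (by simp)).add (ih fun l hl => hK l (by simp [hl]))

theorem IsPosKernel.list_sum {α : Type*} (l : List α) {K : α → ι → ι → ℤ}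
    (hK : ∀ k ∈ l, IsPosKernel (K k)) : IsPosKernel fun x y => (l.map fun k => K k x y).sum := by
  induction l with
  | nil => simpa using IsPosKernel.zero
  | cons k l ih =>
    simp only [List.map_cons, List.sum_cons]
    exact (hK k (by simp)).add (ih fun m hm => hK m (by simp [hm]))

theorem IsPosKernel.mul [Finite ι] {K L : ι → ι → ℤ} (hK : IsPosKernel K) (hL : IsPosKernel L) :
    IsPosKernel fun x y => K x y * L x y := by
  have e : (Matrix.of fun x y => ((K x y * L x y : ℤ) : ℂ)) =
      (Matrix.of fun x y => (K x y : ℂ)) ⊙ (Matrix.of fun x y => (L x y : ℂ)) := by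
    ext x y
    simp
  rw [IsPosKernel, e]
  exact Matrix.PosSemidef.hadamard hK hL

theorem isPosKernel_rankOne [Finite ι] (f : ι → ℤ) : IsPosKernel fun x y => f x * f y := by
  have h := Matrix.posSemidef_vecMulVec_self_star (fun x => (f x : ℂ))
  unfold IsPosKernel
  convert h using 1
  ext x y
  simp [Matrix.vecMulVec_apply]

theorem IsPosKernel.of_const_mul {c : ℤ} (hc : 0 < c) {K : ι → ι → ℤ}
    (hK : IsPosKernel fun x y => c * K x y) : IsPosKernel K := by
  have hc' : (0 : ℂ) ≤ ((c : ℂ))⁻¹ := by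
    have : (0 : ℂ) ≤ (c : ℂ) := by exact_mod_cast hc.le
    exact inv_nonneg.mpr this
  have h := Matrix.PosSemidef.smul hK hc'
  unfold IsPosKernel
  convert h using 1
  ext x y
  have : (c : ℂ) ≠ 0 := by exact_mod_cast hc.ne'
  simp [this]

end IsPosKernel

/-! ### A symmetric elimination test for small matrices -/

/-- One step of fraction-free symmetric elimination at the pivot `k`. -/
def eliminate {m : ℕ} (P : Fin m → Fin m → ℤ) (k i j : Fin m) : ℤ :=
  P k k * P i j - P i k * P j k

/-- Elimination along the pivots in the list, each positive or skipped if zero, ends in `0`. -/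
def eliminatesToZero {m : ℕ} : List (Fin m) → (Fin m → Fin m → ℤ) → Bool
  | [], P => decide (∀ i j, P i j = 0)
  | k :: ks, P =>
    if P k k = 0 then eliminatesToZero ks P
    else decide (0 < P k k) && eliminatesToZero ks (eliminate P k)

/-- Each step writes `P k k * P` as the rank-one kernel of column `k` plus `eliminate P k`. Skipping
a zero pivot is safe because the final remainder is checked to be 0. -/
theorem isPosKernel_of_eliminatesToZero {ι : Type*} [Finite ι] {m : ℕ} (ks : List (Fin m))
    (P : Fin m → Fin m → ℤ) (h : eliminatesToZero ks P = true) (f : ι → Fin m) :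
    IsPosKernel fun x y => P (f x) (f y) := by
  induction ks generalizing P with
  | nil =>
    have h0 : ∀ i j, P i j = 0 := by simpa [eliminatesToZero] using h
    simpa [h0] using IsPosKernel.zero
  | cons k ks ih =>
    rw [eliminatesToZero] at h
    split_ifs at h with hk
    · exact ih P h
    · rw [Bool.and_eq_true, decide_eq_true_eq] at h
      refine IsPosKernel.of_const_mul h.1 ?_
      have := (isPosKernel_rankOne fun x => P (f x) k).add (ih _ h.2)
      convert this using 3
      simp [eliminate]

/-! ### Zonal kernels on Pauli labels -/

/-- The indicator of a non-identity Pauli matrix. -/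
def nonId (c : Fin 4) : ℤ := if c = 0 then 0 else 1

/-- Three times the projection, for non-identity labels, orthogonal to the constants. -/
def siteKernel (c d : Fin 4) : ℤ := if c = 0 ∨ d = 0 then 0 else if c = d then 2 else -1

section Zonal

variable {n : ℕ}

/-- Sum over `r` disjoint ordered pairs of sites in `U` of products of differences of the
support indicators at the two sites of a pair. -/
def diffKernel (x y : PauliLabel n) : ℕ → Finset (Fin n) → ℤ
  | 0, _ => 1
  | r + 1, U => ∑ u ∈ U, ∑ v ∈ U,
      ((nonId (x u) - nonId (x v)) * (nonId (y u) - nonId (y v))) *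
        diffKernel x y r ((U.erase u).erase v)

/-- Sum over `a` distinct sites in `U`, carrying `siteKernel`, and `r` disjoint pairs of the
remaining sites, carrying differences of support indicators. -/
def zonalKernel (r : ℕ) (x y : PauliLabel n) : ℕ → Finset (Fin n) → ℤ
  | 0, U => diffKernel x y r U
  | a + 1, U => ∑ u ∈ U, siteKernel (x u) (y u) * zonalKernel r x y a (U.erase u)

theorem isPosKernel_diffKernel (r : ℕ) (U : Finset (Fin n)) :
    IsPosKernel fun x y : PauliLabel n => diffKernel x y r U := by
  induction r generalizing U with
  | zero => simpa [diffKernel] using isPosKernel_rankOne (fun _ : PauliLabel n => 1)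
  | succ r ih =>
    simp only [diffKernel]
    exact IsPosKernel.sum _ fun u _ => IsPosKernel.sum _ fun v _ =>
      (isPosKernel_rankOne fun x : PauliLabel n => nonId (x u) - nonId (x v)).mul (ih _)

theorem isPosKernel_siteKernel (u : Fin n) :
    IsPosKernel fun x y : PauliLabel n => siteKernel (x u) (y u) := by
  let g : Fin 4 → Fin 4 → ℤ := fun c e => if e = 0 then 0 else if c = 0 then 0 else
    if e = c then 2 else -1
  -- Being three times a projection, the site matrix M satisfies M² = 3M; `g c` is its row `c`.
  have key : ∀ e e' : Fin 4, 3 * siteKernel e e' = ∑ c, g c e * g c e' := by decide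
  refine IsPosKernel.of_const_mul (c := 3) (by norm_num) ?_
  simp only [key]
  exact IsPosKernel.sum _ fun c _ => isPosKernel_rankOne fun x : PauliLabel n => g c (x u)

theorem isPosKernel_zonalKernel (r a : ℕ) (U : Finset (Fin n)) :
    IsPosKernel fun x y : PauliLabel n => zonalKernel r x y a U := by
  induction a generalizing U with
  | zero => exact isPosKernel_diffKernel r U
  | succ a ih =>
    simp only [zonalKernel]
    exact IsPosKernel.sum _ fun u _ => (isPosKernel_siteKernel u).mul (ih _)

/-! ### Values of the zonal kernels -/

/-- The value of `diffKernel` in terms of the numbers of sites where both labels, only the first,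
only the second, and none of the labels are non-identity. -/
def diffValue : ℕ → ℕ → ℕ → ℕ → ℕ → ℤ
  | 0, _, _, _, _ => 1
  | r + 1, t, b, c, z =>
    2 * t * z * diffValue r (t - 1) b c (z - 1) - 2 * b * c * diffValue r t (b - 1) (c - 1) z

/-- The value of `zonalKernel` in terms of the numbers of sites where the labels are
non-identity and equal, non-identity and different, and as in `diffValue`. -/
def zonalValue (r : ℕ) : ℕ → ℕ → ℕ → ℕ → ℕ → ℕ → ℤ
  | 0, p, d, b, c, z => diffValue r (p + d) b c z
  | a + 1, p, d, b, c, z =>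
    2 * p * zonalValue r a (p - 1) d b c z - d * zonalValue r a p (d - 1) b c z

variable (x y : PauliLabel n) (U : Finset (Fin n))

/-- Number of sites where both labels are non-identity. -/
def numBoth : ℕ := (U.filter fun k => x k ≠ 0 ∧ y k ≠ 0).card
/-- Number of sites where only the first label is non-identity. -/
def numLeft : ℕ := (U.filter fun k => x k ≠ 0 ∧ y k = 0).card
/-- Number of sites where only the second label is non-identity. -/
def numRight : ℕ := (U.filter fun k => x k = 0 ∧ y k ≠ 0).card
/-- Number of sites where both labels are the identity. -/
def numNone : ℕ := (U.filter fun k => x k = 0 ∧ y k = 0).card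
/-- Number of sites where the labels are equal and non-identity. -/
def numEq : ℕ := (U.filter fun k => x k ≠ 0 ∧ x k = y k).card
/-- Number of sites where the labels anticommute. -/
def numAnti : ℕ := (U.filter fun k => x k ≠ 0 ∧ y k ≠ 0 ∧ x k ≠ y k).card

theorem card_filter_erase (P : Fin n → Prop) [DecidablePred P] {u : Fin n} (hu : u ∈ U) :
    ((U.erase u).filter P).card = (U.filter P).card - if P u then 1 else 0 := by
  rw [Finset.filter_erase]
  split_ifs with h
  · exact Finset.card_erase_of_mem (by simp [hu, h])
  · rw [Finset.erase_eq_of_notMem (by simp [h])]; rfl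

theorem sum_sum_indicator (P Q : Fin n → Prop) [DecidablePred P] [DecidablePred Q] (A : ℤ) :
    ∑ u ∈ U, ∑ v ∈ U, (if P u ∧ Q v then A else 0)
      = (U.filter P).card * (U.filter Q).card * A := by
  simp only [Finset.card_filter, Nat.cast_sum]
  rw [Finset.sum_mul_sum, Finset.sum_mul]
  refine Finset.sum_congr rfl fun u _ => ?_
  rw [Finset.sum_mul]
  refine Finset.sum_congr rfl fun v _ => ?_
  by_cases hP : P u <;> by_cases hQ : Q v <;> simp [hP, hQ]

/-- A pair (u, v) contributes only if both supports separate u from v: +1 for a both/none pair, -1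
for a left/right pair, each in two orders. Erasing the pair lowers the two counts involved by one.
Truncated subtraction is harmless, since a zero count also kills the factor in front. -/
theorem diffKernel_eq_diffValue (r : ℕ) : diffKernel x y r U =
    diffValue r (numBoth x y U) (numLeft x y U) (numRight x y U) (numNone x y U) := by
  induction r generalizing U with
  | zero => rfl
  | succ r ih =>
    set A := diffValue r (numBoth x y U - 1) (numLeft x y U) (numRight x y U) (numNone x y U - 1)
      with hA
    set B := diffValue r (numBoth x y U) (numLeft x y U - 1) (numRight x y U - 1) (numNone x y U)
      with hB
    have key : ∀ u ∈ U, ∀ v ∈ U,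
        ((nonId (x u) - nonId (x v)) * (nonId (y u) - nonId (y v))) *
          diffKernel x y r ((U.erase u).erase v) =
        (if (x u ≠ 0 ∧ y u ≠ 0) ∧ (x v = 0 ∧ y v = 0) then A else 0) +
        (if (x u = 0 ∧ y u = 0) ∧ (x v ≠ 0 ∧ y v ≠ 0) then A else 0) +
        (if (x u ≠ 0 ∧ y u = 0) ∧ (x v = 0 ∧ y v ≠ 0) then -B else 0) +
        (if (x u = 0 ∧ y u ≠ 0) ∧ (x v ≠ 0 ∧ y v = 0) then -B else 0) := by
      intro u hu v hv
      -- For u = v both sides vanish; otherwise v survives the first erasure.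
      by_cases huv : v = u
      · subst huv
        by_cases h1 : x v = 0 <;> by_cases h2 : y v = 0 <;> simp [h1, h2]
      have hv' : v ∈ U.erase u := by simp [huv, hv]
      rw [ih]
      simp only [numBoth, numLeft, numRight, numNone] at hA hB ⊢
      simp only [card_filter_erase _ _ hv', card_filter_erase _ _ hu, hA, hB]
      by_cases h1 : x u = 0 <;> by_cases h2 : y u = 0 <;> by_cases h3 : x v = 0 <;>
        by_cases h4 : y v = 0 <;> simp [h1, h2, h3, h4, nonId]
    rw [diffKernel, Finset.sum_congr rfl fun u hu => Finset.sum_congr rfl (key u hu)]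
    simp only [Finset.sum_add_distrib]
    rw [sum_sum_indicator U (fun u => x u ≠ 0 ∧ y u ≠ 0) (fun v => x v = 0 ∧ y v = 0),
      sum_sum_indicator U (fun u => x u = 0 ∧ y u = 0) (fun v => x v ≠ 0 ∧ y v ≠ 0),
      sum_sum_indicator U (fun u => x u ≠ 0 ∧ y u = 0) (fun v => x v = 0 ∧ y v ≠ 0),
      sum_sum_indicator U (fun u => x u = 0 ∧ y u ≠ 0) (fun v => x v ≠ 0 ∧ y v = 0)]
    rw [diffValue]
    simp only [← hA, ← hB]
    simp only [numBoth, numLeft, numRight, numNone]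
    ring

theorem numEq_add_numAnti : numEq x y U + numAnti x y U = numBoth x y U := by
  rw [numEq, numAnti, numBoth, ← Finset.card_union_of_disjoint]
  · congr 1
    ext k
    simp only [Finset.mem_union, Finset.mem_filter]
    grind
  · rw [Finset.disjoint_filter]
    grind

theorem zonalKernel_eq_zonalValue (r a : ℕ) : zonalKernel r x y a U =
    zonalValue r a (numEq x y U) (numAnti x y U) (numLeft x y U) (numRight x y U)
      (numNone x y U) := by
  induction a generalizing U with
  | zero => rw [zonalKernel, zonalValue, diffKernel_eq_diffValue, numEq_add_numAnti]
  | succ a ih =>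
    set A := zonalValue r a (numEq x y U - 1) (numAnti x y U) (numLeft x y U) (numRight x y U)
      (numNone x y U) with hA
    set B := zonalValue r a (numEq x y U) (numAnti x y U - 1) (numLeft x y U) (numRight x y U)
      (numNone x y U) with hB
    have key : ∀ u ∈ U, siteKernel (x u) (y u) * zonalKernel r x y a (U.erase u) =
        (if x u ≠ 0 ∧ x u = y u then 2 * A else 0) +
        (if x u ≠ 0 ∧ y u ≠ 0 ∧ x u ≠ y u then -B else 0) := by
      intro u hu
      rw [ih]
      simp only [numEq, numAnti, numLeft, numRight, numNone] at hA hB ⊢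
      simp only [card_filter_erase _ _ hu, hA, hB]
      by_cases h1 : x u = 0
      · simp [h1, siteKernel]
      · by_cases h2 : y u = 0
        · simp [h1, h2, siteKernel]
        · by_cases h3 : x u = y u
          · simp [h2, h3, siteKernel]
          · simp [h1, h2, h3, siteKernel]
    rw [zonalKernel, Finset.sum_congr rfl key, Finset.sum_add_distrib, ← Finset.sum_filter,
      ← Finset.sum_filter, Finset.sum_const, Finset.sum_const, zonalValue, ← hA, ← hB]
    simp only [numEq, numAnti, nsmul_eq_mul]
    ring

end Zonal


/-! ### Pauli strings -/

theorem sum_sum_prod {ι α β : Type*} [Fintype ι] [DecidableEq ι] [Fintype α] [Fintype β]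
    (f : ι → α → β → ℂ) :
    ∑ x : ι → α, ∑ y : ι → β, ∏ k, f k (x k) (y k) = ∏ k, ∑ a, ∑ b, f k a b := by
  rw [Fintype.prod_sum]
  exact Finset.sum_congr rfl fun x _ => (Fintype.prod_sum _).symm

theorem conjTranspose_pauli (c : Fin 4) : (pauli c)ᴴ = pauli c := by
  fin_cases c <;> ext i j <;> fin_cases i <;> fin_cases j <;>
    simp [pauli, Matrix.conjTranspose_apply]

theorem conjTranspose_pauliString_apply {n : ℕ} (a : PauliLabel n) (x y : Qubits n) :
    (pauliString a)ᴴ x y = ∏ k, (pauli (a k))ᴴ (x k) (y k) := by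
  simp [pauliString, Matrix.conjTranspose_apply]

theorem pauli_conjTranspose_mul (c d : Fin 4) :
    (pauli c)ᴴ * pauli d = (if c ≠ 0 ∧ d ≠ 0 ∧ c ≠ d then (-1 : ℂ) else 1) •
      (pauli d * (pauli c)ᴴ) := by
  rw [conjTranspose_pauli]
  fin_cases c <;> fin_cases d <;> ext i j <;> fin_cases i <;> fin_cases j <;> simp [pauli]

/-- Both products factor over the sites, and each anticommuting site contributes a sign -1. -/
theorem pauliString_anticomm {n : ℕ} (a b : PauliLabel n)
    (h : Odd (numAnti a b Finset.univ)) :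
    (pauliString a)ᴴ * pauliString b = -(pauliString b * (pauliString a)ᴴ) := by
  have hl : ∀ x y, ((pauliString a)ᴴ * pauliString b) x y =
      ∏ k, ((pauli (a k))ᴴ * pauli (b k)) (x k) (y k) := by
    intro x y
    simp only [Matrix.mul_apply, conjTranspose_pauliString_apply, Fintype.prod_sum]
    simp [pauliString, Finset.prod_mul_distrib]
  have hr : ∀ x y, (pauliString b * (pauliString a)ᴴ) x y =
      ∏ k, (pauli (b k) * (pauli (a k))ᴴ) (x k) (y k) := by
    intro x y
    simp only [Matrix.mul_apply, conjTranspose_pauliString_apply, Fintype.prod_sum]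
    simp [pauliString, Finset.prod_mul_distrib]
  have hs : ∏ k, (if a k ≠ 0 ∧ b k ≠ 0 ∧ a k ≠ b k then (-1 : ℂ) else 1) = -1 := by
    rw [Finset.prod_ite]
    simp only [Finset.prod_const, one_pow, mul_one]
    exact h.neg_one_pow
  ext x y
  rw [hl, Matrix.neg_apply, hr]
  simp only [pauli_conjTranspose_mul, Matrix.smul_apply, smul_eq_mul, Finset.prod_mul_distrib, hs]
  ring

/-! ### The diagonal of a feasible point -/

theorem trace_pauli_kronecker_mul_Pplus (c : Fin 4) :
    ∑ p : Fin 2 × Fin 2, ∑ q : Fin 2 × Fin 2, pauli c p.1 q.1 * (pauli c)ᴴ p.2 q.2 * Pplus q p =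
      if c = 0 then 3 else 1 := by
  fin_cases c <;> simp [Fintype.sum_prod_type, Fin.sum_univ_two, pauli, Pplus, swap,
    Matrix.one_apply] <;> norm_num

theorem trace_pauli_kronecker_mul_Pminus (c : Fin 4) :
    ∑ p : Fin 2 × Fin 2, ∑ q : Fin 2 × Fin 2, pauli c p.1 q.1 * (pauli c)ᴴ p.2 q.2 * Pminus q p =
      if c = 0 then 1 else -1 := by
  fin_cases c <;> simp [Fintype.sum_prod_type, Fin.sum_univ_two, pauli, Pminus, swap,
    Matrix.one_apply] <;> norm_num

theorem trace_pauliString_kronecker_mul_projTerm (a : PauliLabel 7) (T : Finset (Fin 7)) :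
    ((pauliString a ⊗ₖ (pauliString a)ᴴ) * projTerm T).trace =
      ∏ k, if k ∈ T then (if a k = 0 then 1 else -1 : ℂ) else if a k = 0 then 3 else 1 := by
  have key : ∀ k, (if k ∈ T then (if a k = 0 then 1 else -1 : ℂ) else if a k = 0 then 3 else 1) =
      ∑ p : Fin 2 × Fin 2, ∑ q : Fin 2 × Fin 2, pauli (a k) p.1 q.1 * (pauli (a k))ᴴ p.2 q.2 *
        (if k ∈ T then Pminus else Pplus) q p := by
    intro k
    by_cases hT : k ∈ T <;> simp only [hT, if_true, if_false]
    · exact (trace_pauli_kronecker_mul_Pminus (a k)).symm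
    · exact (trace_pauli_kronecker_mul_Pplus (a k)).symm
  simp only [key]
  rw [← sum_sum_prod]
  let e : (Fin 7 → Fin 2 × Fin 2) ≃ Qubits 7 × Qubits 7 := Equiv.arrowProdEquivProdArrow _ _ _
  simp only [Matrix.trace, Matrix.diag_apply, Matrix.mul_apply]
  rw [← e.sum_comp]
  refine Finset.sum_congr rfl fun p _ => ?_
  rw [← e.sum_comp]
  refine Finset.sum_congr rfl fun q _ => ?_
  rw [Matrix.kroneckerMap_apply, conjTranspose_pauliString_apply]
  simp only [Finset.prod_mul_distrib]
  rfl

/-- Generating function: the variable marks the sites in `T`, here those carrying `Pminus`. -/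
theorem sum_powersetCard_prod_ite {ι : Type*} [Fintype ι] [DecidableEq ι] (f g : ι → ℂ) (m : ℕ) :
    ∑ T ∈ (Finset.univ : Finset ι).powersetCard m, ∏ k, (if k ∈ T then f k else g k) =
      (∏ k, (Polynomial.C (f k) * Polynomial.X + Polynomial.C (g k))).coeff m := by
  rw [Fintype.prod_add, Polynomial.finsetSum_coeff,
    ← Finset.sum_subset (Finset.subset_univ (Finset.univ.powersetCard m))]
  · refine Finset.sum_congr rfl fun T hT => ?_
    rw [Finset.mem_powersetCard] at hT
    rw [Finset.prod_mul_distrib, Finset.prod_const, hT.2, ← map_prod, ← map_prod, mul_right_comm,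
      ← map_mul, Polynomial.coeff_C_mul_X_pow, if_pos rfl, Finset.prod_ite]
    congr 1 <;> refine Finset.prod_congr ?_ fun _ _ => rfl <;> ext <;> simp
  · intro T _ hT
    rw [Finset.prod_mul_distrib, Finset.prod_const, ← map_prod, ← map_prod, mul_right_comm,
      ← map_mul, Polynomial.coeff_C_mul_X_pow, if_neg]
    exact fun h => hT (Finset.mem_powersetCard.mpr ⟨Finset.subset_univ T, h.symm⟩)

/-- The number of non-identity sites of a Pauli label. -/
def weight {n : ℕ} (x : PauliLabel n) : ℕ := (Finset.univ.filter fun k => x k ≠ 0).card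

theorem trace_pauliString_kronecker_mul_PhiE8 (a : PauliLabel 7) :
    ((pauliString a ⊗ₖ (pauliString a)ᴴ) * PhiE8).trace =
      ∑ i : Fin 4, coeff i * (((Polynomial.X + Polynomial.C 3) ^ (7 - weight a) *
        (Polynomial.C 1 - Polynomial.X) ^ weight a : Polynomial ℂ)).coeff (2 * (i : ℕ)) := by
  rw [PhiE8, Matrix.mul_sum, Matrix.trace_sum]
  refine Finset.sum_congr rfl fun i _ => ?_
  rw [Matrix.mul_smul, Matrix.trace_smul, Matrix.mul_sum, Matrix.trace_sum, smul_eq_mul]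
  simp only [trace_pauliString_kronecker_mul_projTerm]
  rw [sum_powersetCard_prod_ite (fun k => if a k = 0 then 1 else -1)
    (fun k => if a k = 0 then 3 else 1)]
  have hf : ∀ k, Polynomial.C (if a k = 0 then 1 else -1 : ℂ) * Polynomial.X +
      Polynomial.C (if a k = 0 then 3 else 1 : ℂ) =
      if a k ≠ 0 then Polynomial.C 1 - Polynomial.X else Polynomial.X + Polynomial.C 3 := by
    intro k
    split_ifs <;> simp_all
    ring
  have hw : (Finset.univ.filter fun k => ¬ a k ≠ 0).card = 7 - weight a := by
    have := Finset.card_filter_add_card_filter_not (s := (Finset.univ : Finset (Fin 7)))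
      (fun k => a k ≠ 0)
    rw [Finset.card_univ, Fintype.card_fin] at this
    rw [weight]
    omega
  simp only [hf]
  rw [Finset.prod_ite, Finset.prod_const, Finset.prod_const, hw, weight, mul_comm (_ ^ _)]

open Polynomial in
theorem trace_of_weight_eq_four {a : PauliLabel 7} (h : weight a = 4) :
    ((pauliString a ⊗ₖ (pauliString a)ᴴ) * PhiE8).trace = 1 / 81 := by
  have hp : ((X + C 3) ^ (7 - 4) * (C 1 - X) ^ 4 : ℂ[X]) =
      C 27 * X ^ 0 + C (-81) * X ^ 1 + C 63 * X ^ 2 + C 19 * X ^ 3 + C (-31) * X ^ 4 + C (-3) * X ^ 5 + C 5 * X ^ 6 + C 1 * X ^ 7 := by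
    simp only [map_neg, map_ofNat, map_one]
    ring
  rw [trace_pauliString_kronecker_mul_PhiE8, h, hp]
  simp [Fin.sum_univ_four, coeff, coeff_C_mul, coeff_X, coeff_X_pow, -map_neg, -map_one]
  norm_num

open Polynomial in
theorem trace_of_weight_eq_five {a : PauliLabel 7} (h : weight a = 5) :
    ((pauliString a ⊗ₖ (pauliString a)ᴴ) * PhiE8).trace = 2 / 243 := by
  have hp : ((X + C 3) ^ (7 - 5) * (C 1 - X) ^ 5 : ℂ[X]) =
      C 9 * X ^ 0 + C (-39) * X ^ 1 + C 61 * X ^ 2 + C (-35) * X ^ 3 + C (-5) * X ^ 4 + C 11 * X ^ 5 + C (-1) * X ^ 6 + C (-1) * X ^ 7 := by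
    simp only [map_neg, map_ofNat, map_one]
    ring
  rw [trace_pauliString_kronecker_mul_PhiE8, h, hp]
  simp [Fin.sum_univ_four, coeff, coeff_C_mul, coeff_X, coeff_X_pow, -map_neg, -map_one]
  norm_num

open Polynomial in
theorem trace_of_weight_eq_six {a : PauliLabel 7} (h : weight a = 6) :
    ((pauliString a ⊗ₖ (pauliString a)ᴴ) * PhiE8).trace = 4 / 729 := by
  have hp : ((X + C 3) ^ (7 - 6) * (C 1 - X) ^ 6 : ℂ[X]) =
      C 3 * X ^ 0 + C (-17) * X ^ 1 + C 39 * X ^ 2 + C (-45) * X ^ 3 + C 25 * X ^ 4 + C (-3) * X ^ 5 + C (-3) * X ^ 6 + C 1 * X ^ 7 := by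
    simp only [map_neg, map_ofNat, map_one]
    ring
  rw [trace_pauliString_kronecker_mul_PhiE8, h, hp]
  simp [Fin.sum_univ_four, coeff, coeff_C_mul, coeff_X, coeff_X_pow, -map_neg, -map_one]
  norm_num

open Polynomial in
theorem trace_of_weight_eq_seven {a : PauliLabel 7} (h : weight a = 7) :
    ((pauliString a ⊗ₖ (pauliString a)ᴴ) * PhiE8).trace = 22 / 2187 := by
  have hp : ((X + C 3) ^ (7 - 7) * (C 1 - X) ^ 7 : ℂ[X]) =
      C 1 * X ^ 0 + C (-7) * X ^ 1 + C 21 * X ^ 2 + C (-35) * X ^ 3 + C 35 * X ^ 4 + C (-21) * X ^ 5 + C 7 * X ^ 6 + C (-1) * X ^ 7 := by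
    simp only [map_neg, map_ofNat, map_one]
    ring
  rw [trace_pauliString_kronecker_mul_PhiE8, h, hp]
  simp [Fin.sum_univ_four, coeff, coeff_C_mul, coeff_X, coeff_X_pow, -map_neg, -map_one]
  norm_num


/-! ### The dual certificate -/

/-- The class of a weight: `0, 4, 5, 6, 7` have classes `0, …, 4`, all others class `5`. -/
def weightClass : ℕ → Fin 6
  | 0 => 0
  | 4 => 1
  | 5 => 2
  | 6 => 3
  | 7 => 4
  | _ => 5

/-- Entry of a table indexed by weight classes; class `5` is out of range and gives `0`. -/
def tableEntry (T : List (List ℤ)) (i j : Fin 6) : ℤ := (T.getD i []).getD j 0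

/-- For each `(a, r)`, the positive semidefinite matrix, indexed by weight classes, that multiplies
`zonalKernel r` at `a` in the dual solution. -/
def dualBlocks : List (ℕ × ℕ × List (List ℤ)) := [
  (0, 0, [[432450424990080, -3434252048640, -3563611873920, -3730889030400, -2670702814080],
    [-3434252048640, 30225218688, 25520209920, 31315507200, 19708738560],
    [-3563611873920, 25520209920, 33603793920, 28156792320, 21646517760],
    [-3730889030400, 31315507200, 28156792320, 35473075200, 21161710080],
    [-2670702814080, 19708738560, 21646517760, 21161710080, 21968956800]]),
  (0, 1, [[0, 0, 0, 0, 0],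
    [0, 434966112, 271786752, -466715520, 0],
    [0, 271786752, 195851520, -213321600, 0],
    [0, -466715520, -213321600, 806371200, 0],
    [0, 0, 0, 0, 0]]),
  (0, 2, [[0, 0, 0, 0, 0],
    [0, 159375384, -41604192, 0, 0],
    [0, -41604192, 120944880, 0, 0],
    [0, 0, 0, 0, 0],
    [0, 0, 0, 0, 0]]),
  (0, 3, [[0, 0, 0, 0, 0],
    [0, 3544506, 0, 0, 0],
    [0, 0, 0, 0, 0],
    [0, 0, 0, 0, 0],
    [0, 0, 0, 0, 0]]),
  (1, 0, [[0, 0, 0, 0, 0],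
    [0, 3585272544, -523418112, -1676505600, 795795840],
    [0, -523418112, 238726656, 389612160, -137168640],
    [0, -1676505600, 389612160, 1257439680, 206478720],
    [0, 795795840, -137168640, 206478720, 1308867840]]),
  (1, 1, [[0, 0, 0, 0, 0],
    [0, 690817680, -266626080, 457047360, 0],
    [0, -266626080, 773304840, -78684480, 0],
    [0, 457047360, -78684480, 369442080, 0],
    [0, 0, 0, 0, 0]]),
  (1, 2, [[0, 0, 0, 0, 0],
    [0, 46903374, 49778064, 0, 0],
    [0, 49778064, 53508924, 0, 0],
    [0, 0, 0, 0, 0],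
    [0, 0, 0, 0, 0]]),
  (1, 3, [[0, 0, 0, 0, 0],
    [0, 69677685, 0, 0, 0],
    [0, 0, 0, 0, 0],
    [0, 0, 0, 0, 0],
    [0, 0, 0, 0, 0]]),
  (2, 0, [[0, 0, 0, 0, 0],
    [0, 1604492064, 361863936, 716542848, -416949120],
    [0, 361863936, 1206938880, -662401152, 258007680],
    [0, 716542848, -662401152, 1185020928, -106323840],
    [0, -416949120, 258007680, -106323840, 669009600]]),
  (2, 1, [[0, 0, 0, 0, 0],
    [0, 1087859808, 25437888, -328007232, 0],
    [0, 25437888, 18023040, 17019072, 0],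
    [0, -328007232, 17019072, 135463104, 0],
    [0, 0, 0, 0, 0]]),
  (2, 2, [[0, 0, 0, 0, 0],
    [0, 107463510, -106709400, 0, 0],
    [0, -106709400, 106059240, 0, 0],
    [0, 0, 0, 0, 0],
    [0, 0, 0, 0, 0]]),
  (3, 0, [[0, 0, 0, 0, 0],
    [0, 658037520, -387102240, -48036240, 309536640],
    [0, -387102240, 435526560, 170886240, -117028800],
    [0, -48036240, 170886240, 102483360, 22075200],
    [0, 309536640, -117028800, 22075200, 166474560]]),
  (3, 1, [[0, 0, 0, 0, 0],
    [0, 1211905800, 235531800, 242109000, 0],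
    [0, 235531800, 235853100, -78480360, 0],
    [0, 242109000, -78480360, 131317200, 0],
    [0, 0, 0, 0, 0]]),
  (3, 2, [[0, 0, 0, 0, 0],
    [0, 0, 0, 0, 0],
    [0, 0, 8820, 0, 0],
    [0, 0, 0, 0, 0],
    [0, 0, 0, 0, 0]]),
  (4, 0, [[0, 0, 0, 0, 0],
    [0, 1384160400, -174363840, -237686400, -170553600],
    [0, -174363840, 56901600, -16793280, 56337120],
    [0, -237686400, -16793280, 103924800, -17660160],
    [0, -170553600, 56337120, -17660160, 56002800]]),
  (4, 1, [[0, 0, 0, 0, 0],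
    [0, 0, 0, 0, 0],
    [0, 0, 170518320, 56130480, 0],
    [0, 0, 56130480, 18501840, 0],
    [0, 0, 0, 0, 0]]),
  (5, 0, [[0, 0, 0, 0, 0],
    [0, 0, 0, 0, 0],
    [0, 0, 72288720, -24334128, -24195024],
    [0, 0, -24334128, 8225280, 8161776],
    [0, 0, -24195024, 8161776, 8114064]]),
  (5, 1, [[0, 0, 0, 0, 0],
    [0, 0, 0, 0, 0],
    [0, 0, 0, 0, 0],
    [0, 0, 0, 25439400, 0],
    [0, 0, 0, 0, 0]]),
  (6, 0, [[0, 0, 0, 0, 0],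
    [0, 0, 0, 0, 0],
    [0, 0, 0, 0, 0],
    [0, 0, 0, 2563344, -2569392],
    [0, 0, 0, -2569392, 2589832]]),
  (7, 0, [[0, 0, 0, 0, 0],
    [0, 0, 0, 0, 0],
    [0, 0, 0, 0, 0],
    [0, 0, 0, 0, 0],
    [0, 0, 0, 0, 856]])]

/-- The dual solution as a kernel on Pauli labels. -/
def dualKernel (x y : PauliLabel 7) : ℤ :=
  (dualBlocks.map fun B => tableEntry B.2.2 (weightClass (weight x)) (weightClass (weight y)) *
    zonalKernel B.2.1 x y B.1 Finset.univ).sum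

/-- The value of the dual solution in terms of the site counts of a pair of labels. -/
def dualValue (p d b c : ℕ) : ℤ :=
  (dualBlocks.map fun B =>
    tableEntry B.2.2 (weightClass (p + d + b)) (weightClass (p + d + c)) *
      zonalValue B.2.1 B.1 p d b c (7 - (p + d + b + c))).sum

theorem dualBlocks_eliminatesToZero :
    ∀ B ∈ dualBlocks, eliminatesToZero (List.finRange 6) (tableEntry B.2.2) = true := by
  decide +kernel

theorem isPosKernel_dualKernel : IsPosKernel dualKernel :=
  IsPosKernel.list_sum dualBlocks fun B hB =>
    (isPosKernel_of_eliminatesToZero _ _ (dualBlocks_eliminatesToZero B hB) _).mul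
      (isPosKernel_zonalKernel _ _ _)

/-- Dual feasibility. The three conditions `≠ 0` say that the first label is nonzero, the second is
nonzero, and the two differ; even `d` means that they commute. -/
theorem dualValue_eq_zero_of_even : ∀ p d b c : Fin 8,
    (p.val + d + b + c ≤ 7 ∧ d.val % 2 = 0 ∧ p.val + d + b ≠ 0 ∧ p.val + d + c ≠ 0 ∧
      d.val + b + c ≠ 0) → dualValue p d b c = 0 := by
  decide +kernel

/-- The contribution of a label of weight `w` to the pairing of the dual solution with a feasible
point, divided by the diagonal entry at that label. -/
def dualWeight (w : ℕ) : ℤ := if w = 0 then dualValue 0 0 0 0 else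
  dualValue 0 0 w 0 + dualValue 0 0 0 w + dualValue w 0 0 0

theorem dualWeight_values : dualWeight 0 = 432450424990080 ∧ dualWeight 1 = 0 ∧ dualWeight 2 = 0 ∧
    dualWeight 3 = 0 ∧ dualWeight 4 = -3429931236480 ∧ dualWeight 5 = -3560525579520 ∧
    dualWeight 6 = -3725421880320 ∧ dualWeight 7 = -2666117462400 := by
  decide +kernel

/-! ### Pairing a feasible point with the dual solution -/

section Counts

variable (x y : PauliLabel 7)

theorem weight_left : numEq x y Finset.univ + numAnti x y Finset.univ + numLeft x y Finset.univ =
    weight x := by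
  rw [numEq_add_numAnti, numBoth, numLeft, weight, ← Finset.card_union_of_disjoint]
  · congr 1
    ext k
    simp only [Finset.mem_union, Finset.mem_filter]
    grind
  · rw [Finset.disjoint_filter]
    grind

theorem weight_right : numEq x y Finset.univ + numAnti x y Finset.univ + numRight x y Finset.univ =
    weight y := by
  rw [numEq_add_numAnti, numBoth, numRight, weight, ← Finset.card_union_of_disjoint]
  · congr 1
    ext k
    simp only [Finset.mem_union, Finset.mem_filter]
    grind
  · rw [Finset.disjoint_filter]
    grind

theorem weight_add_numRight_add_numNone :
    weight x + numRight x y Finset.univ + numNone x y Finset.univ = 7 := by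
  have h1 : numRight x y Finset.univ + numNone x y Finset.univ =
      (Finset.univ.filter fun k => ¬ x k ≠ 0).card := by
    rw [numRight, numNone, ← Finset.card_union_of_disjoint]
    · congr 1
      ext k
      simp only [Finset.mem_union, Finset.mem_filter]
      grind
    · rw [Finset.disjoint_filter]
      grind
  have h2 := Finset.card_filter_add_card_filter_not (s := (Finset.univ : Finset (Fin 7)))
    (fun k => x k ≠ 0)
  rw [Finset.card_univ, Fintype.card_fin] at h2
  rw [weight]
  omega

theorem dualKernel_eq_dualValue : dualKernel x y = dualValue (numEq x y Finset.univ)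
    (numAnti x y Finset.univ) (numLeft x y Finset.univ) (numRight x y Finset.univ) := by
  have h := weight_add_numRight_add_numNone x y
  have hl := weight_left x y
  have hz : numNone x y Finset.univ = 7 - (numEq x y Finset.univ + numAnti x y Finset.univ +
    numLeft x y Finset.univ + numRight x y Finset.univ) := by omega
  rw [dualKernel, dualValue, weight_left, weight_right]
  simp only [zonalKernel_eq_zonalValue, hz, weight_left]

variable {x y}

theorem weight_eq_zero_iff : weight x = 0 ↔ x = 0 := by
  rw [weight, Finset.card_eq_zero, Finset.filter_eq_empty_iff]
  constructor
  · intro h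
    ext1 k
    simpa using h (Finset.mem_univ k)
  · rintro rfl
    simp

theorem eq_of_counts_eq_zero (hd : numAnti x y Finset.univ = 0) (hl : numLeft x y Finset.univ = 0)
    (hr : numRight x y Finset.univ = 0) : x = y := by
  rw [numAnti, Finset.card_eq_zero, Finset.filter_eq_empty_iff] at hd
  rw [numLeft, Finset.card_eq_zero, Finset.filter_eq_empty_iff] at hl
  rw [numRight, Finset.card_eq_zero, Finset.filter_eq_empty_iff] at hr
  ext1 k
  have h1 := hd (Finset.mem_univ k)
  have h2 := hl (Finset.mem_univ k)
  have h3 := hr (Finset.mem_univ k)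
  grind

theorem dualKernel_eq_zero (hx : x ≠ 0) (hy : y ≠ 0) (hxy : x ≠ y)
    (hd : ¬ Odd (numAnti x y Finset.univ)) : dualKernel x y = 0 := by
  have h := weight_add_numRight_add_numNone x y
  have hl := weight_left x y
  have hr := weight_right x y
  have hx' := mt weight_eq_zero_iff.mp hx
  have hy' := mt weight_eq_zero_iff.mp hy
  have hn : numAnti x y Finset.univ + numLeft x y Finset.univ + numRight x y Finset.univ ≠ 0 :=
    fun h0 => hxy (eq_of_counts_eq_zero (by omega) (by omega) (by omega))
  rw [Nat.not_odd_iff] at hd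
  rw [dualKernel_eq_dualValue]
  generalize numEq x y Finset.univ = p, numAnti x y Finset.univ = d,
    numLeft x y Finset.univ = b, numRight x y Finset.univ = c at *
  exact dualValue_eq_zero_of_even ⟨p, by omega⟩ ⟨d, by omega⟩ ⟨b, by omega⟩ ⟨c, by omega⟩
    ⟨by dsimp only; omega, hd, by dsimp only; omega, by dsimp only; omega, hn⟩

end Counts

theorem dualKernel_zero_right (x : PauliLabel 7) : dualKernel x 0 = dualValue 0 0 (weight x) 0 := by
  rw [dualKernel_eq_dualValue]
  congr 1 <;> simp [numEq, numAnti, numLeft, numRight, weight]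

theorem dualKernel_zero_left (y : PauliLabel 7) : dualKernel 0 y = dualValue 0 0 0 (weight y) := by
  rw [dualKernel_eq_dualValue]
  congr 1
  simp [numRight, weight]

theorem dualKernel_self (x : PauliLabel 7) : dualKernel x x = dualValue (weight x) 0 0 0 := by
  rw [dualKernel_eq_dualValue]
  congr 1
  all_goals simp [numEq, numAnti, numLeft, numRight, weight]

/-- The common diagonal entry of a feasible point at the labels of weight `w`, for
`w ∈ {0, 4, 5, 6, 7}`. -/
noncomputable def diagEntry (w : ℕ) : ℂ :=
  if w = 0 then 1 else if w = 4 then 1 / 81 else if w = 5 then 2 / 243 else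
    if w = 6 then 4 / 729 else 22 / 2187

theorem star_diagEntry (w : ℕ) : star (diagEntry w) = diagEntry w := by
  unfold diagEntry
  split_ifs <;> simp

theorem IsFeasible.diag_eq {Γ : Matrix (PauliLabel 7) (PauliLabel 7) ℂ} (h : IsFeasible Γ)
    {x : PauliLabel 7} (hx : 4 ≤ weight x) : Γ x x = diagEntry (weight x) := by
  have hle : weight x ≤ 7 := by have := weight_add_numRight_add_numNone x x; omega
  rw [h.diag]
  obtain hw | hw | hw | hw : weight x = 4 ∨ weight x = 5 ∨ weight x = 6 ∨ weight x = 7 := by omega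
  · rw [trace_of_weight_eq_four hw, hw]; norm_num [diagEntry]
  · rw [trace_of_weight_eq_five hw, hw]; norm_num [diagEntry]
  · rw [trace_of_weight_eq_six hw, hw]; norm_num [diagEntry]
  · rw [trace_of_weight_eq_seven hw, hw]; norm_num [diagEntry]

/-- These weights fall in the zero class of the tables, so the diagonal of Γ there is never needed
and the default value of `diagEntry` is immaterial. -/
theorem dualValue_low_weight : ∀ w ∈ [1, 2, 3], dualValue 0 0 w 0 = 0 ∧ dualValue 0 0 0 w = 0 ∧
    dualValue w 0 0 0 = 0 := by
  decide +kernel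

theorem IsFeasible.pairing_eq {Γ : Matrix (PauliLabel 7) (PauliLabel 7) ℂ} (h : IsFeasible Γ) :
    ∑ x, ∑ y, (dualKernel x y : ℂ) * Γ x y =
      ∑ x : PauliLabel 7, (dualWeight (weight x) : ℂ) * diagEntry (weight x) := by
  set G : PauliLabel 7 → PauliLabel 7 → ℂ := fun x y => (dualKernel x y : ℂ) * Γ x y with hG
  -- Column 0, diagonal and row 0 meet at (0, 0); the inner conditions count that entry once, in the
  -- column.
  have hsplit : ∀ x y, G x y = (if y = 0 then G x 0 else 0) +
      (if y = x then (if x = 0 then 0 else G x x) else 0) +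
      (if x = 0 then (if y = 0 then 0 else G 0 y) else 0) := by
    intro x y
    by_cases hx : x = 0
    · by_cases hy : y = 0 <;> simp [hx, hy]
    by_cases hy : y = 0
    · simp [hx, hy, Ne.symm hx]
    by_cases hxy : y = x
    · simp [hx, hxy]
    simp only [hx, hy, hxy, if_false, add_zero]
    by_cases hd : Odd (numAnti x y Finset.univ)
    · simp [hG, h.anticomm x y (pauliString_anticomm x y hd)]
    · simp [hG, dualKernel_eq_zero hx hy (Ne.symm hxy) hd]
  have hsum : ∑ x, ∑ y, G x y = ∑ x, (G x 0 + (if x = 0 then 0 else G x x) +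
      (if x = 0 then 0 else G 0 x)) := by
    simp only [Finset.sum_congr rfl fun x _ => Finset.sum_congr rfl fun y _ => hsplit x y,
      Finset.sum_add_distrib]
    congr 1
    · simp
    · rw [Finset.sum_comm]
      simp
  rw [hsum]
  refine Finset.sum_congr rfl fun x _ => ?_
  by_cases hx : x = 0
  · subst hx
    have hw : weight (0 : PauliLabel 7) = 0 := weight_eq_zero_iff.mpr rfl
    simp [hG, h.zero_zero, dualKernel_zero_right, hw, dualWeight, diagEntry]
  have hx' := mt weight_eq_zero_iff.mp hx
  simp only [hx, if_false, hG, dualKernel_zero_right, dualKernel_zero_left, dualKernel_self]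
  by_cases hw : 4 ≤ weight x
  · have hd := h.diag_eq hw
    have h0 : Γ 0 x = diagEntry (weight x) := by
      rw [← h.posSemidef.isHermitian.apply, h.col_zero, hd, star_diagEntry]
    rw [h.col_zero, hd, h0, dualWeight, if_neg hx']
    push_cast
    ring
  · obtain ⟨h1, h2, h3⟩ := dualValue_low_weight (weight x)
      (by simp only [List.mem_cons, List.not_mem_nil]; omega)
    simp [h1, h2, h3, dualWeight, hx']

/-! ### Counting labels by weight, and the contradiction. -/

theorem weight_cons {n : ℕ} (c : Fin 4) (x : PauliLabel n) :
    weight (Fin.cons c x : PauliLabel (n + 1)) = (if c = 0 then 0 else 1) + weight x := by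
  simp only [weight, Finset.card_filter, Fin.sum_univ_succ, Fin.cons_zero, Fin.cons_succ]
  simp

/-- Summing out one site of a function of the weight. -/
def weightStep (F : ℕ → ℂ) (w : ℕ) : ℂ := F w + 3 * F (w + 1)

theorem sum_weight_succ {n : ℕ} (F : ℕ → ℂ) :
    ∑ x : PauliLabel (n + 1), F (weight x) = ∑ x : PauliLabel n, weightStep F (weight x) := by
  rw [← (Fin.consEquiv fun _ => Fin 4).sum_comp, Fintype.sum_prod_type, Finset.sum_comm]
  refine Finset.sum_congr rfl fun x _ => ?_
  have hc : ∀ c, weight ((Fin.consEquiv fun _ => Fin 4) (c, x)) =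
      (if c = 0 then 0 else 1) + weight x := fun c => weight_cons c x
  simp only [hc, Fin.sum_univ_four, weightStep]
  simp [add_comm 1]
  ring

/-- There are 3^w · C(7, w) labels of weight w. -/
theorem sum_weight (F : ℕ → ℂ) : ∑ x : PauliLabel 7, F (weight x) =
    F 0 + 21 * F 1 + 189 * F 2 + 945 * F 3 + 2835 * F 4 + 5103 * F 5 + 5103 * F 6 + 2187 * F 7 := by
  rw [sum_weight_succ, sum_weight_succ, sum_weight_succ, sum_weight_succ, sum_weight_succ,
    sum_weight_succ, sum_weight_succ]
  simp only [Finset.univ_unique, Finset.sum_singleton, weight, Finset.univ_eq_empty,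
    Finset.filter_empty, Finset.card_empty, weightStep]
  ring

theorem not_isFeasible (Γ : Matrix (PauliLabel 7) (PauliLabel 7) ℂ) : ¬ IsFeasible Γ := by
  intro h
  have hpos : 0 ≤ ∑ x, ∑ y, (dualKernel x y : ℂ) * Γ x y := by
    -- The pairing is the quadratic form of the Hadamard product at the all-ones vector.
    have := (Matrix.PosSemidef.hadamard isPosKernel_dualKernel h.posSemidef).dotProduct_mulVec_nonneg
      1
    simpa [dotProduct, Matrix.mulVec] using this
  obtain ⟨h0, h1, h2, h3, h4, h5, h6, h7⟩ := dualWeight_values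
  rw [h.pairing_eq, sum_weight fun w => (dualWeight w : ℂ) * diagEntry w] at hpos
  simp only [h0, h1, h2, h3, h4, h5, h6, h7, diagEntry] at hpos
  -- The diagonal entries of weights 4, 5, 6, 7 sum to 35, 42, 28, 22, and the pairing equals
  -- -105639448320.
  norm_num at hpos

end E8State

theorem mainTheorem2 :
    ¬ ∃ Γ : Matrix (E8State.PauliLabel 7) (E8State.PauliLabel 7) ℂ, E8State.IsFeasible Γ := by
  rintro ⟨Γ, h⟩
  exact E8State.not_isFeasible Γ h
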